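/- Let $M$ be a pointed metric space, that is, a metric space with distance $d$ and a fixed point $0\in M$. Let $\mathrm{Lip}_0(M)$ be the Banach space of all Lipschitz functions $f\colon M\to\mathbb R$ with $f(0)=0$, with the norm $\|f\|=\sup\{|f(x)-f(y)|/d(x,y) : x,y\in M,\ x\ne y\}$. Put $\widetilde M=\{(x,y)\in M\times M : x\neq y\}$ and, for $A\subseteq M$, $\Gamma_A=\{(x,y)\in\widetilde M : x\in A \text{ or } y\in A\}$. We say that $M$ has the *function LTP* if for every bounded finitely additive measure $\mu$ with non-negative values on the power set of $\widetilde M$, every $\varepsilon\in(0,1)$, every $n\in\mathbb N$ and all $f_1,\dots,f_n\in\mathrm{Lip}_0(M)$ with $\|f_i\|\le 1$, there exist $A\subseteq M$ with $\mu(\Gamma_A)<\varepsilon$ and $u,v\in A$ with $u\ne v$ such that $$(1-\varepsilon)\bigl(f_i(x)-f_i(y)+d(u,v)\bigr)\le d(x,u)+d(y,v)\qquad\text{for all } x,y\in M\setminus A \text{ and } i\in\{1,\dots,n\}.$$ We say that $M$ has the *seq-LTP* if for every $\varepsilon>0$ there exist pairwise disjoint subsets $A_1,A_2,\dots$ of $M$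 and elements $u_m,v_m\in A_m$ with $u_m\neq v_m$ such that $$(1-\varepsilon)\bigl(d(x,y)+d(u_m,v_m)\bigr)\le d(x,u_m)+d(y,v_m)\qquad\text{for all } m\in\mathbb N \text{ and } x,y\in M\setminus A_m.$$ A slice of the closed unit ball $B_X$ of a real Banach space $X$ is a set $\{x\in B_X : x^*(x)>1-\alpha\}$ with $x^*\in X^*$, $\|x^*\|=1$ and $\alpha>0$. The space $X$ has the *strong diameter 2 property* (SD2P) if for all $n\in\mathbb N$, all $\lambda_1,\dots,\lambda_n\ge 0$ with $\sum_{i=1}^n\lambda_i=1$ and all slices $S_1,\dots,S_n$ of $B_X$, the set $\sum_{i=1}^n\lambda_iS_i$ has diameter $2$. **Theorem.** 1. If a pointed metric space $M$ has the function LTP, then $\mathrm{Lip}_0(M)$ has the SD2P. 2. The function LTP is strictly weaker than the seq-LTP: every pointed metric space with the seq-LTP has the function LTP, and there is a pointed metric space that has the function LTP but not the seq-LTP. -/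

import Mathlib

open scoped NNReal

noncomputable section

/-- The set of pairs `(x, y)` of points of `M` with `x ≠ y`, as a type. -/
abbrev OffDiag (M : Type*) : Type _ := {p : M × M // p.1 ≠ p.2}

/-- `Γ_A`: the pairs `(x, y)` with `x ≠ y` such that `x ∈ A` or `y ∈ A`. -/
def gammaSet {M : Type*} (A : Set M) : Set (OffDiag M) :=
  {p | p.1.1 ∈ A ∨ p.1.2 ∈ A}

/-- Bounded finitely additive signed measures on the power set of `E`. -/
structure BA (E : Type*) where
  toFun : Set E → ℝ
  additive : ∀ S T : Set E, Disjoint S T → toFun (S ∪ T) = toFun S + toFun T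
  bounded : ∃ C : ℝ, ∀ S : Set E, |toFun S| ≤ C

/-- The vector space of real Lipschitz functions on `M` vanishing at the base point `o`. -/
def lipSubmodule {M : Type*} [MetricSpace M] (o : M) : Submodule ℝ (M → ℝ) where
  carrier := {f | f o = 0 ∧ ∃ K : ℝ≥0, LipschitzWith K f}
  zero_mem' := ⟨rfl, 0, LipschitzWith.const 0⟩
  add_mem' := by
    rintro f g ⟨hf, K, hK⟩ ⟨hg, L, hL⟩
    exact ⟨by simp [hf, hg], K + L, hK.add hL⟩
  smul_mem' := by
    rintro c f ⟨hf, K, hK⟩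
    refine ⟨by simp [hf], ‖c‖₊ * K, LipschitzWith.of_dist_le_mul fun x y => ?_⟩
    have h := hK.dist_le_mul x y
    simp only [Pi.smul_apply, smul_eq_mul, Real.dist_eq, NNReal.coe_mul, coe_nnnorm,
      Real.norm_eq_abs, ← mul_sub, abs_mul] at h ⊢
    rw [mul_assoc]
    exact mul_le_mul_of_nonneg_left h (abs_nonneg c)

/-- `Lip₀(M)` for the metric space `M` with base point `o`. A type synonym, so that its only
topology is the one of the norm defined below. -/
def Lip0 {M : Type*} [MetricSpace M] (o : M) : Type _ := ↥(lipSubmodule o)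

namespace Lip0

variable {M : Type*} [MetricSpace M] {o : M}

instance : AddCommGroup (Lip0 o) := inferInstanceAs (AddCommGroup ↥(lipSubmodule o))

instance : Module ℝ (Lip0 o) := inferInstanceAs (Module ℝ ↥(lipSubmodule o))

instance : CoeFun (Lip0 o) (fun _ => M → ℝ) := ⟨fun f => f.1⟩

/-- `‖f‖ = sup {|f x - f y| / d(x, y) : x ≠ y}`. -/
instance : Norm (Lip0 o) :=
  ⟨fun f => ⨆ p : OffDiag M, |f p.1.1 - f p.1.2| / dist p.1.1 p.1.2⟩

theorem norm_def (f : Lip0 o) :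
    ‖f‖ = ⨆ p : OffDiag M, |f p.1.1 - f p.1.2| / dist p.1.1 p.1.2 := rfl

theorem add_apply (f g : Lip0 o) (x : M) : (f + g) x = f x + g x := rfl

theorem smul_apply (c : ℝ) (f : Lip0 o) (x : M) : (c • f) x = c * f x := rfl

theorem map_base (f : Lip0 o) : f o = 0 := f.2.1

theorem bddAbove_slopes (f : Lip0 o) :
    BddAbove (Set.range fun p : OffDiag M => |f p.1.1 - f p.1.2| / dist p.1.1 p.1.2) := by
  obtain ⟨K, hK⟩ := f.2.2
  refine ⟨K, ?_⟩
  rintro _ ⟨p, rfl⟩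
  have h := hK.dist_le_mul p.1.1 p.1.2
  rw [Real.dist_eq] at h
  exact (div_le_iff₀ (dist_pos.2 p.2)).2 h

theorem norm_nonneg' (f : Lip0 o) : 0 ≤ ‖f‖ :=
  Real.iSup_nonneg fun _ => div_nonneg (abs_nonneg _) dist_nonneg

theorem abs_sub_le (f : Lip0 o) (x y : M) : |f x - f y| ≤ ‖f‖ * dist x y := by
  by_cases h : x = y
  · simp [h]
  · exact (div_le_iff₀ (dist_pos.2 h)).1 (le_ciSup (bddAbove_slopes f) ⟨(x, y), h⟩)

theorem norm_le_of {f : Lip0 o} {C : ℝ} (hC : 0 ≤ C)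
    (h : ∀ x y, |f x - f y| ≤ C * dist x y) : ‖f‖ ≤ C :=
  Real.iSup_le (fun p => (div_le_iff₀ (dist_pos.2 p.2)).2 (h _ _)) hC

theorem norm_smul_le' (c : ℝ) (f : Lip0 o) : ‖c • f‖ ≤ ‖c‖ * ‖f‖ := by
  refine norm_le_of (mul_nonneg (norm_nonneg c) (norm_nonneg' f)) fun x y => ?_
  rw [smul_apply, smul_apply, ← mul_sub, abs_mul, mul_assoc, Real.norm_eq_abs]
  exact mul_le_mul_of_nonneg_left (abs_sub_le f x y) (abs_nonneg c)

theorem core : NormedSpace.Core ℝ (Lip0 o) where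
  norm_nonneg := norm_nonneg'
  norm_smul c f := by
    refine le_antisymm (norm_smul_le' c f) ?_
    rcases eq_or_ne c 0 with rfl | hc
    · simpa using norm_nonneg' (0 : Lip0 o)
    · have h := norm_smul_le' c⁻¹ (c • f)
      rw [inv_smul_smul₀ hc, norm_inv] at h
      have hc' : 0 < ‖c‖ := norm_pos_iff.2 hc
      calc ‖c‖ * ‖f‖ ≤ ‖c‖ * (‖c‖⁻¹ * ‖c • f‖) := mul_le_mul_of_nonneg_left h hc'.le
        _ = ‖c • f‖ := by field_simp
  norm_triangle f g := by
    refine norm_le_of (add_nonneg (norm_nonneg' f) (norm_nonneg' g)) fun x y => ?_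
    have h : (f + g) x - (f + g) y = (f x - f y) + (g x - g y) := by
      rw [add_apply, add_apply]; ring
    rw [h, add_mul]
    exact (abs_add_le _ _).trans (add_le_add (abs_sub_le f x y) (abs_sub_le g x y))
  norm_eq_zero_iff f := by
    constructor
    · intro h
      refine Subtype.ext (funext fun x => ?_)
      have hx := abs_sub_le f x o
      rw [h, zero_mul, map_base, sub_zero] at hx
      exact abs_nonpos_iff.1 hx
    · rintro rfl
      refine le_antisymm (norm_le_of le_rfl fun x y => ?_) (norm_nonneg' _)
      have h0 : ∀ z : M, (0 : Lip0 o) z = 0 := fun _ => rfl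
      simp [h0]

instance : NormedAddCommGroup (Lip0 o) := NormedAddCommGroup.ofCore core

instance : NormedSpace ℝ (Lip0 o) := NormedSpace.ofCore core

end Lip0

/-- The subset `{x ∈ B_X : φ x > 1 - α}` of the closed unit ball of `X`; it is a slice when
`‖φ‖ = 1` and `α > 0`. -/
def slice {X : Type*} [NormedAddCommGroup X] [NormedSpace ℝ X] (φ : X →L[ℝ] ℝ) (α : ℝ) : Set X :=
  {x | ‖x‖ ≤ 1 ∧ 1 - α < φ x}

/-- The strong diameter 2 property: every convex combination of slices of the closed unit ball
has diameter 2. -/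
def StrongDiameterTwo (X : Type*) [NormedAddCommGroup X] [NormedSpace ℝ X] : Prop :=
  ∀ (n : ℕ) (w : Fin n → ℝ) (φ : Fin n → X →L[ℝ] ℝ) (α : Fin n → ℝ),
    (∀ i, 0 ≤ w i) → ∑ i, w i = 1 → (∀ i, ‖φ i‖ = 1) → (∀ i, 0 < α i) →
    Metric.diam {x : X | ∃ y : Fin n → X, (∀ i, y i ∈ slice (φ i) (α i)) ∧
      x = ∑ i, w i • y i} = 2

/-- The function LTP of the metric space `M` with base point `o`. Here `ε` ranges over `(0, 1)`:
the condition is about small `ε`, and for `ε > 1` the factor `1 - ε` would reverse the meaning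
of the inequality. -/
def FunctionLTP {M : Type*} [MetricSpace M] (o : M) : Prop :=
  ∀ μ : BA (OffDiag M), (∀ S, 0 ≤ μ.toFun S) →
    ∀ ε : ℝ, 0 < ε → ε < 1 →
    ∀ (n : ℕ) (f : Fin n → Lip0 o), (∀ i, ‖f i‖ ≤ 1) →
    ∃ (A : Set M) (u v : M), μ.toFun (gammaSet A) < ε ∧ u ∈ A ∧ v ∈ A ∧ u ≠ v ∧
      ∀ x y : M, x ∉ A → y ∉ A → ∀ i,
        (1 - ε) * (f i x - f i y + dist u v) ≤ dist x u + dist y v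

/-- The seq-LTP. -/
def SeqLTP (M : Type*) [MetricSpace M] : Prop :=
  ∀ ε : ℝ, 0 < ε →
    ∃ (A : ℕ → Set M) (u v : ℕ → M), (∀ k m, k ≠ m → Disjoint (A k) (A m)) ∧
      (∀ m, u m ∈ A m ∧ v m ∈ A m ∧ u m ≠ v m) ∧
      ∀ (m : ℕ) (x y : M), x ∉ A m → y ∉ A m →
        (1 - ε) * (dist x y + dist (u m) (v m)) ≤ dist x (u m) + dist y (v m)

end

/-!
By Hahn-Banach, a functional on `Lip₀(M)` extends along the de Leeuw embedding `f ↦ (slopes of f)`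
to `ℓ^∞`, and the total variation of the extension is a finitely additive measure `μ` such that the
functional has norm at most `μ(Γ_A)` on the functions that are constant off `A`. For finitely many
slices take `f i` in a smaller slice and apply the function LTP to the functions `± f i` and the sum
of these measures. The inequality obtained is exactly what allows `(1 - ε) f i` to be extended, from
the complement of `A`, to a 1-Lipschitz function with slope `1 - ε`, or `-(1 - ε)`, at `(u, v)`.
Since `μ(Γ_A) < ε`, both extensions stay in the slices, and the molecule `(δ_u - δ_v) / d(u, v)`
separates them by `2 (1 - ε)`, simultaneously for all the slices.

The seq-LTP implies the function LTP because a bounded measure gives small mass to all but finitely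
many of the `Γ_{A_m}`, the sets `A_m` being disjoint.

The two properties differ on the half graph, with distance `2` along its edges and `1` between other
points. A 1-Lipschitz function cannot separate `l a` from any `r k` by much more than `1` when `a`
is large, so the distances `2` are invisible to finitely many functions. For the seq-LTP, however,
each `A_m` would have to contain `l 0`, or `r 1`, or almost all `l i`, or almost all `r k`, for
otherwise there are `x` and `y` off `A_m` at distance `2` with `d(x, u_m) = d(y, v_m) = 1`; and no
two disjoint sets can contain the same one of these.
-/

open Filter

/-! ### Finitely additive measures and functionals on `ℓ^∞` -/

namespace BA

section

variable {E : Type*} {μ : BA E}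

theorem toFun_empty (μ : BA E) : μ.toFun ∅ = 0 := by
  simpa using μ.additive ∅ ∅ (Set.disjoint_empty _)

theorem toFun_biUnion_finset (μ : BA E) {ι : Type*} {B : ι → Set E} {s : Finset ι}
    (hB : (s : Set ι).PairwiseDisjoint B) :
    μ.toFun (⋃ i ∈ s, B i) = ∑ i ∈ s, μ.toFun (B i) := by
  classical
  induction s using Finset.induction_on with
  | empty => simpa using μ.toFun_empty
  | insert a s ha ih =>
    rw [Finset.coe_insert] at hB
    have hdisj : Disjoint (B a) (⋃ i ∈ s, B i) :=
      Set.disjoint_iUnion₂_right.2 fun i hi =>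
        hB (Set.mem_insert a _) (Set.mem_insert_of_mem a hi) (ne_of_mem_of_not_mem hi ha).symm
    rw [Finset.set_biUnion_insert, μ.additive _ _ hdisj, Finset.sum_insert ha,
      ih (hB.subset (Set.subset_insert _ _))]

theorem mono (hμ : ∀ S, 0 ≤ μ.toFun S) {S T : Set E} (hST : S ⊆ T) :
    μ.toFun S ≤ μ.toFun T := by
  have hsplit := μ.additive S (T \ S) Set.disjoint_sdiff_right
  rw [Set.union_sdiff_cancel hST] at hsplit
  linarith [hμ (T \ S)]

theorem union_le (hμ : ∀ S, 0 ≤ μ.toFun S) (S T : Set E) :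
    μ.toFun (S ∪ T) ≤ μ.toFun S + μ.toFun T := by
  have hsplit := μ.additive S (T \ S) Set.disjoint_sdiff_right
  rw [Set.union_sdiff_self] at hsplit
  linarith [mono hμ (Set.sdiff_subset : T \ S ⊆ T)]

theorem eventually_cofinite_lt (hμ : ∀ S, 0 ≤ μ.toFun S) {ι : Type*} {B : ι → Set E}
    (hB : Pairwise (Function.onFun Disjoint B)) {ε : ℝ} (hε : 0 < ε) :
    ∀ᶠ i in cofinite, μ.toFun (B i) < ε := by
  simp only [eventually_cofinite, not_lt]
  by_contra hinf
  obtain ⟨N, hN⟩ := exists_nat_gt (μ.toFun Set.univ / ε)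
  obtain ⟨s, hs, rfl⟩ := Set.Infinite.exists_subset_card_eq hinf N
  have hle : s.card * ε ≤ μ.toFun Set.univ :=
    calc s.card * ε = ∑ _i ∈ s, ε := by rw [Finset.sum_const, nsmul_eq_mul]
      _ ≤ ∑ i ∈ s, μ.toFun (B i) := Finset.sum_le_sum fun _ hi => hs hi
      _ = μ.toFun (⋃ i ∈ s, B i) := (μ.toFun_biUnion_finset (hB.set_pairwise _)).symm
      _ ≤ μ.toFun Set.univ := mono hμ (Set.subset_univ _)
  exact hle.not_gt ((div_lt_iff₀ hε).1 hN)

/-- The pointwise sum of a finite family of finitely additive measures; it is used to replace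
finitely many measures by a single one dominating all of them. -/
def sum {ι : Type*} [Fintype ι] (μ : ι → BA E) : BA E where
  toFun S := ∑ i, (μ i).toFun S
  additive S T h := by
    rw [← Finset.sum_add_distrib]
    exact Finset.sum_congr rfl fun i _ => (μ i).additive S T h
  bounded := by
    choose C hC using fun i => (μ i).bounded
    exact ⟨∑ i, C i, fun S =>
      (Finset.abs_sum_le_sum_abs _ _).trans (Finset.sum_le_sum fun i _ => hC i S)⟩

end

theorem eventually_cofinite_gammaSet_lt {M : Type*} {μ : BA (OffDiag M)}
    (hμ : ∀ S, 0 ≤ μ.toFun S) {ι : Type*} {A : ι → Set M}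
    (hA : Pairwise (Function.onFun Disjoint A)) {ε : ℝ} (hε : 0 < ε) :
    ∀ᶠ i in cofinite, μ.toFun (gammaSet (A i)) < ε := by
  have hfst : Pairwise (Function.onFun Disjoint fun i => {p : OffDiag M | p.1.1 ∈ A i}) :=
    fun i j hij => (hA hij).preimage fun p : OffDiag M => p.1.1
  have hsnd : Pairwise (Function.onFun Disjoint fun i => {p : OffDiag M | p.1.2 ∈ A i}) :=
    fun i j hij => (hA hij).preimage fun p : OffDiag M => p.1.2
  filter_upwards [eventually_cofinite_lt hμ hfst (half_pos hε),
    eventually_cofinite_lt hμ hsnd (half_pos hε)] with i hi₁ hi₂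
  calc μ.toFun (gammaSet (A i))
      ≤ μ.toFun {p | p.1.1 ∈ A i} + μ.toFun {p | p.1.2 ∈ A i} := union_le hμ _ _
    _ < ε := by linarith

end BA

section Variation

open scoped ENNReal Pointwise

variable {E : Type*} {F : E → Type*} [∀ e, NormedAddCommGroup (F e)]

open Classical in
/-- The restriction of `h ∈ ℓ^∞` to `S`: it agrees with `h` on `S` and vanishes off `S`. -/
noncomputable def lpRestrict (S : Set E) (h : lp F ∞) : lp F ∞ :=
  ⟨S.piecewise h 0, memℓp_infty ⟨‖h‖, by
    rintro _ ⟨p, rfl⟩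
    by_cases hp : p ∈ S <;> simp [hp, lp.norm_apply_le_norm]⟩⟩

theorem lpRestrict_apply_of_mem {S : Set E} {p : E} (hp : p ∈ S) (h : lp F ∞) :
    lpRestrict S h p = h p := by
  simp [lpRestrict, hp]

theorem lpRestrict_apply_of_notMem {S : Set E} {p : E} (hp : p ∉ S) (h : lp F ∞) :
    lpRestrict S h p = 0 := by
  simp [lpRestrict, hp]

theorem norm_lpRestrict_le (S : Set E) (h : lp F ∞) : ‖lpRestrict S h‖ ≤ ‖h‖ := by
  refine lp.norm_le_of_forall_le (norm_nonneg h) fun p => ?_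
  by_cases hp : p ∈ S
  · rw [lpRestrict_apply_of_mem hp]
    exact lp.norm_apply_le_norm (by simp) h p
  · simp [lpRestrict_apply_of_notMem hp]

/-- The elements of the closed unit ball of `ℓ^∞` that vanish off `S`. -/
def supportedBall (F : E → Type*) [∀ e, NormedAddCommGroup (F e)] (S : Set E) : Set (lp F ∞) :=
  {h | ‖h‖ ≤ 1 ∧ ∀ p ∉ S, h p = 0}

theorem zero_mem_supportedBall (S : Set E) : (0 : lp F ∞) ∈ supportedBall F S :=
  ⟨by simp, fun _ _ => rfl⟩

theorem supportedBall_union {S T : Set E} (hST : Disjoint S T) :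
    supportedBall F (S ∪ T) = supportedBall F S + supportedBall F T := by
  ext h
  rw [Set.mem_add]
  constructor
  · rintro ⟨hnorm, hsupp⟩
    refine ⟨lpRestrict S h, ⟨(norm_lpRestrict_le S h).trans hnorm,
      fun p hp => lpRestrict_apply_of_notMem hp h⟩, lpRestrict T h,
      ⟨(norm_lpRestrict_le T h).trans hnorm, fun p hp => lpRestrict_apply_of_notMem hp h⟩, ?_⟩
    ext p
    rw [lp.coeFn_add, Pi.add_apply]
    by_cases hS : p ∈ S
    · rw [lpRestrict_apply_of_mem hS, lpRestrict_apply_of_notMem (hST.notMem_of_mem_left hS),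
        add_zero]
    rw [lpRestrict_apply_of_notMem hS, zero_add]
    by_cases hT : p ∈ T
    · rw [lpRestrict_apply_of_mem hT]
    · rw [lpRestrict_apply_of_notMem hT, hsupp p (by simp [hS, hT])]
  · rintro ⟨a, ⟨ha, haS⟩, b, ⟨hb, hbT⟩, rfl⟩
    refine ⟨lp.norm_le_of_forall_le zero_le_one fun p => ?_, fun p hp => ?_⟩
    · rw [lp.coeFn_add, Pi.add_apply]
      by_cases hS : p ∈ S
      · rw [hbT p (hST.notMem_of_mem_left hS), add_zero]
        exact (lp.norm_apply_le_norm (by simp) a p).trans ha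
      · rw [haS p hS, zero_add]
        exact (lp.norm_apply_le_norm (by simp) b p).trans hb
    · rw [Set.mem_union, not_or] at hp
      rw [lp.coeFn_add, Pi.add_apply, haS p hp.1, hbT p hp.2, add_zero]

variable [∀ e, NormedSpace ℝ (F e)] (ψ : lp F ∞ →L[ℝ] ℝ)

theorem apply_le_opNorm_of_mem_supportedBall {S : Set E} {h : lp F ∞}
    (hh : h ∈ supportedBall F S) : ψ h ≤ ‖ψ‖ :=
  (le_abs_self _).trans (ψ.unit_le_opNorm h hh.1)

theorem image_supportedBall_nonempty (S : Set E) : (ψ '' supportedBall F S).Nonempty :=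
  ⟨_, Set.mem_image_of_mem ψ (zero_mem_supportedBall S)⟩

theorem bddAbove_image_supportedBall (S : Set E) : BddAbove (ψ '' supportedBall F S) :=
  ⟨‖ψ‖, Set.forall_mem_image.2 fun _ => apply_le_opNorm_of_mem_supportedBall ψ⟩

theorem sSup_image_supportedBall_nonneg (S : Set E) : 0 ≤ sSup (ψ '' supportedBall F S) :=
  le_csSup (bddAbove_image_supportedBall ψ S) ⟨0, zero_mem_supportedBall S, map_zero ψ⟩

/-- The total variation of the finitely additive measure representing the functional `ψ` on
`ℓ^∞`: its value at `S` is the norm of `ψ` on the functions supported in `S`. -/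
noncomputable def variation : BA E where
  toFun S := sSup (ψ '' supportedBall F S)
  additive S T hST := by
    rw [supportedBall_union hST, Set.image_add ψ,
      csSup_add (image_supportedBall_nonempty ψ S) (bddAbove_image_supportedBall ψ S)
        (image_supportedBall_nonempty ψ T) (bddAbove_image_supportedBall ψ T)]
  bounded := ⟨‖ψ‖, fun S => by
    rw [abs_of_nonneg (sSup_image_supportedBall_nonneg ψ S)]
    exact csSup_le (image_supportedBall_nonempty ψ S)
      (Set.forall_mem_image.2 fun _ => apply_le_opNorm_of_mem_supportedBall ψ)⟩

theorem variation_nonneg (S : Set E) : 0 ≤ (variation ψ).toFun S :=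
  sSup_image_supportedBall_nonneg ψ S

theorem apply_le_norm_mul_variation {S : Set E} {h : lp F ∞} (hsupp : ∀ p ∉ S, h p = 0) :
    ψ h ≤ ‖h‖ * (variation ψ).toFun S := by
  rcases eq_or_ne h 0 with rfl | hne
  · simp
  have hpos : 0 < ‖h‖ := norm_pos_iff.2 hne
  have hmem : ‖h‖⁻¹ • h ∈ supportedBall F S :=
    ⟨by rw [norm_smul, norm_inv, norm_norm, inv_mul_cancel₀ hpos.ne'],
      fun p hp => by rw [lp.coeFn_smul, Pi.smul_apply, hsupp p hp, smul_zero]⟩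
  have hle := le_csSup (bddAbove_image_supportedBall ψ S) (Set.mem_image_of_mem ψ hmem)
  rwa [map_smul, smul_eq_mul, inv_mul_le_iff₀ hpos] at hle

end Variation

/-! ### Lipschitz functions -/

theorem exists_comp_linearIsometry_eq {𝕜 X Y : Type*} [RCLike 𝕜] [NormedAddCommGroup X]
    [NormedSpace 𝕜 X] [SeminormedAddCommGroup Y] [NormedSpace 𝕜 Y] (e : X →ₗᵢ[𝕜] Y)
    (φ : X →L[𝕜] 𝕜) : ∃ ψ : Y →L[𝕜] 𝕜, ∀ x, ψ (e x) = φ x := by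
  let e' : X ≃ₗᵢ[𝕜] LinearMap.range e.toLinearMap := e.equivRange
  obtain ⟨ψ, hψ, -⟩ := exists_extension_norm_eq (LinearMap.range e.toLinearMap)
    (φ.comp (e'.symm.toContinuousLinearEquiv : _ →L[𝕜] X))
  refine ⟨ψ, fun x => (hψ (e' x)).trans ?_⟩
  simp

theorem lipschitzOnWith_update_insert {α β : Type*} [PseudoMetricSpace α] [PseudoMetricSpace β]
    [DecidableEq α] {K : ℝ≥0} {F : α → β} {s : Set α} {a : α} {b : β}
    (hF : LipschitzOnWith K F s) (hb : ∀ x ∈ s, dist (F x) b ≤ K * dist x a) :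
    LipschitzOnWith K (Function.update F a b) (insert a s) := by
  have hb' : ∀ x ∈ s, dist (Function.update F a b x) b ≤ K * dist x a := fun x hx => by
    rcases eq_or_ne x a with rfl | hxa
    · simp
    · simpa [hxa] using hb x hx
  refine LipschitzOnWith.of_dist_le_mul ?_
  rintro x (rfl | hx) y (rfl | hy)
  · simp
  · simpa [dist_comm] using hb' y hy
  · simpa using hb' x hx
  · rcases eq_or_ne x a with rfl | hxa
    · simpa [dist_comm] using hb' y hy
    rcases eq_or_ne y a with rfl | hya
    · simpa using hb' x hx
    simpa [hxa, hya] using hF.dist_le_mul x hx y hy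

theorem exists_forall_mem_Icc {α ι : Type*} [ConditionallyCompleteLattice α] [Nonempty α]
    {s : Set ι} {L U : ι → α} (h : ∀ i ∈ s, ∀ j ∈ s, L i ≤ U j) :
    ∃ b, ∀ i ∈ s, b ∈ Set.Icc (L i) (U i) := by
  rcases s.eq_empty_or_nonempty with rfl | hs
  · simp
  obtain ⟨b, hbL, hbU⟩ := exists_between_of_forall_le (hs.image L) (hs.image U)
    (Set.forall_mem_image.2 fun i hi => Set.forall_mem_image.2 fun j hj => h i hi j hj)
  exact ⟨b, fun i hi => ⟨hbL (Set.mem_image_of_mem L hi), hbU (Set.mem_image_of_mem U hi)⟩⟩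

theorem exists_forall_dist_le_and_dist_add_le {M : Type*} [PseudoMetricSpace M] {K : ℝ≥0}
    {F : M → ℝ} {s : Set M} {u v : M} {t : ℝ} (hF : LipschitzOnWith K F s)
    (hFt : ∀ x ∈ s, ∀ y ∈ s, |F x - F y + t| ≤ K * (dist x v + dist y u)) :
    ∃ b, ∀ x ∈ s, dist (F x) b ≤ K * dist x v ∧ dist (F x) (b + t) ≤ K * dist x u := by
  have htriangle : ∀ x ∈ s, ∀ y ∈ s, ∀ z, F x - F y ≤ K * dist x z + K * dist y z :=
    fun x hx y hy z => by
    calc F x - F y ≤ dist (F x) (F y) := Real.sub_le_dist _ _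
      _ ≤ K * dist x y := hF.dist_le_mul x hx y hy
      _ ≤ K * (dist x z + dist y z) := by gcongr; exact dist_triangle_right x y z
      _ = K * dist x z + K * dist y z := mul_add _ _ _
  obtain ⟨b, hb⟩ : ∃ b, ∀ x ∈ s,
      b ∈ Set.Icc (max (F x - K * dist x v) (F x - t - K * dist x u))
        (min (F x + K * dist x v) (F x - t + K * dist x u)) := by
    refine exists_forall_mem_Icc fun x hx y hy => max_le (le_min ?_ ?_) (le_min ?_ ?_)
    · linarith [htriangle x hx y hy v]
    · linarith [(abs_le.1 (hFt x hx y hy)).2]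
    · linarith [(abs_le.1 (hFt y hy x hx)).1]
    · linarith [htriangle x hx y hy u]
  simp only [Set.mem_Icc, max_le_iff, le_min_iff] at hb
  exact ⟨b, fun x hx => ⟨abs_le.2 ⟨by linarith [hb x hx], by linarith [hb x hx]⟩,
    abs_le.2 ⟨by linarith [hb x hx], by linarith [hb x hx]⟩⟩⟩

theorem exists_lipschitzWith_eqOn_sub_eq {M : Type*} [PseudoMetricSpace M] {K : ℝ≥0} {F : M → ℝ}
    {s : Set M} {u v : M} {t : ℝ} (hF : LipschitzOnWith K F s) (ht : |t| ≤ K * dist u v)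
    (hFt : ∀ x ∈ s, ∀ y ∈ s, |F x - F y + t| ≤ K * (dist x v + dist y u)) :
    ∃ G : M → ℝ, LipschitzWith K G ∧ Set.EqOn G F s ∧ G u - G v = t := by
  classical
  obtain ⟨b, hb⟩ := exists_forall_dist_le_and_dist_add_le hF hFt
  have hv : ∀ x ∈ s, dist (F x) b ≤ K * dist x v := fun x hx => (hb x hx).1
  have hu : ∀ x ∈ insert v s, dist (Function.update F v b x) (b + t) ≤ K * dist x u := by
    intro x hx
    rcases eq_or_ne x v with rfl | hxv
    · simpa [dist_comm] using ht
    · simpa [hxv] using (hb x (Set.mem_of_mem_insert_of_ne hx hxv)).2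
  obtain ⟨G, hG, hGF⟩ := (lipschitzOnWith_update_insert
    (lipschitzOnWith_update_insert hF hv) hu).extend_real
  refine ⟨G, hG, fun x hx => ?_, ?_⟩
  · have hxv : x = v → F x = b := by rintro rfl; simpa using (hb x hx).1
    have hxu : x = u → F x = b + t := by rintro rfl; simpa using (hb x hx).2
    rw [← hGF (by simp [hx])]
    grind [Function.update_apply]
  · rw [← hGF (by simp), ← hGF (by simp)]
    rcases eq_or_ne v u with rfl | hvu
    · simpa [eq_comm] using ht
    · simp [hvu]

namespace Lip0

open scoped ENNReal

variable {M : Type*} [MetricSpace M] {o : M}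

theorem neg_apply (f : Lip0 o) (x : M) : (-f) x = -f x := rfl

theorem sub_apply (f g : Lip0 o) (x : M) : (f - g) x = f x - g x := rfl

theorem lipschitzWith_of_norm_le {f : Lip0 o} {K : ℝ≥0} (hf : ‖f‖ ≤ K) : LipschitzWith K f :=
  LipschitzWith.of_dist_le_mul fun x y =>
    (abs_sub_le f x y).trans (mul_le_mul_of_nonneg_right hf dist_nonneg)

theorem abs_sub_le_dist {f : Lip0 o} (hf : ‖f‖ ≤ 1) (x y : M) : |f x - f y| ≤ dist x y :=
  (abs_sub_le f x y).trans (mul_le_of_le_one_left dist_nonneg hf)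

theorem sub_le_dist {f : Lip0 o} (hf : ‖f‖ ≤ 1) (x y : M) : f x - f y ≤ dist x y :=
  (le_abs_self _).trans (abs_sub_le_dist hf x y)

theorem exists_sub_eq_of_lipschitzWith (o : M) {K : ℝ≥0} {G : M → ℝ} (hG : LipschitzWith K G) :
    ∃ g : Lip0 o, ‖g‖ ≤ K ∧ ∀ x y, g x - g y = G x - G y := by
  have hsub : ∀ x y, G x - G o - (G y - G o) = G x - G y := fun x y => sub_sub_sub_cancel_right ..
  have hlip : LipschitzWith K fun x => G x - G o := LipschitzWith.of_dist_le_mul fun x y => by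
    simpa only [Real.dist_eq, hsub] using hG.dist_le_mul x y
  exact ⟨⟨fun x => G x - G o, sub_self _, K, hlip⟩, norm_le_of K.2 hlip.dist_le_mul, hsub⟩

theorem abs_slope_le (f : Lip0 o) (p : OffDiag M) :
    |(f p.1.1 - f p.1.2) / dist p.1.1 p.1.2| ≤ ‖f‖ := by
  rw [abs_div, abs_dist]
  exact (div_le_iff₀ (dist_pos.2 p.2)).2 (abs_sub_le f _ _)

/-- The de Leeuw embedding of `Lip₀(M)` into `ℓ^∞`, which sends a function to its slopes. -/
noncomputable def deLeeuw (o : M) : Lip0 o →ₗᵢ[ℝ] lp (fun _ : OffDiag M => ℝ) ∞ where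
  toFun f := ⟨fun p => (f p.1.1 - f p.1.2) / dist p.1.1 p.1.2,
    memℓp_infty ⟨‖f‖, Set.forall_mem_range.2 (abs_slope_le f)⟩⟩
  map_add' f g := by
    ext p
    rw [lp.coeFn_add, Pi.add_apply]
    simp only [add_apply]
    ring
  map_smul' c f := by
    ext p
    rw [lp.coeFn_smul, Pi.smul_apply]
    simp only [smul_apply, RingHom.id_apply, smul_eq_mul]
    ring
  norm_map' f := by
    rw [lp.norm_eq_ciSup, norm_def]
    simp

theorem deLeeuw_apply (f : Lip0 o) (p : OffDiag M) :
    deLeeuw o f p = (f p.1.1 - f p.1.2) / dist p.1.1 p.1.2 := rfl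

/-- The measure `μ` controls the functional `φ` on `Lip₀(M)`: on the functions that are constant
off a set `A`, the norm of `φ` is at most `μ(Γ_A)`. -/
def DominatedBy (φ : Lip0 o →L[ℝ] ℝ) (μ : BA (OffDiag M)) : Prop :=
  ∀ (A : Set M) (f : Lip0 o), (∀ x ∉ A, ∀ y ∉ A, f x = f y) → φ f ≤ ‖f‖ * μ.toFun (gammaSet A)

theorem exists_dominatedBy (φ : Lip0 o →L[ℝ] ℝ) :
    ∃ μ : BA (OffDiag M), (∀ S, 0 ≤ μ.toFun S) ∧ DominatedBy φ μ := by
  obtain ⟨ψ, hψ⟩ := exists_comp_linearIsometry_eq (deLeeuw o) φ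
  refine ⟨variation ψ, variation_nonneg ψ, fun A f hf => ?_⟩
  have hsupp : ∀ p ∉ gammaSet A, deLeeuw o f p = 0 := fun p hp => by
    obtain ⟨hx, hy⟩ := not_or.1 hp
    rw [deLeeuw_apply, hf _ hx _ hy, sub_self, zero_div]
  simpa only [hψ, LinearIsometry.norm_map] using apply_le_norm_mul_variation ψ hsupp

theorem exists_forall_dominatedBy {ι : Type*} [Finite ι] (φ : ι → Lip0 o →L[ℝ] ℝ) :
    ∃ μ : BA (OffDiag M), (∀ S, 0 ≤ μ.toFun S) ∧ ∀ i, DominatedBy (φ i) μ := by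
  have := Fintype.ofFinite ι
  choose μ hμ hφμ using fun i => exists_dominatedBy (φ i)
  refine ⟨BA.sum μ, fun S => Finset.sum_nonneg fun i _ => hμ i S, fun i A f hf => ?_⟩
  have hle : (μ i).toFun (gammaSet A) ≤ (BA.sum μ).toFun (gammaSet A) :=
    Finset.single_le_sum (f := fun j => (μ j).toFun (gammaSet A)) (fun j _ => hμ j _)
      (Finset.mem_univ i)
  exact (hφμ i A f hf).trans (mul_le_mul_of_nonneg_left hle (norm_nonneg f))

theorem DominatedBy.mem_slice {φ : Lip0 o →L[ℝ] ℝ} {μ : BA (OffDiag M)} (hφ : DominatedBy φ μ)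
    {A : Set M} {f g : Lip0 o} {ε α : ℝ} (hε₀ : 0 < ε) (hε₁ : ε ≤ 1) (hεα : 4 * ε ≤ α)
    (hA : μ.toFun (gammaSet A) < ε) (hf : f ∈ slice φ ε) (hg : ‖g‖ ≤ 1)
    (hfg : ∀ x ∉ A, ∀ y ∉ A, g x - g y = (1 - ε) * (f x - f y)) : g ∈ slice φ α := by
  refine ⟨hg, ?_⟩
  have hnorm : ‖(1 - ε) • f - g‖ ≤ 2 := by
    have hle : ‖(1 - ε) • f‖ ≤ 1 := by
      rw [norm_smul, Real.norm_of_nonneg (by linarith)]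
      exact mul_le_one₀ (by linarith) (norm_nonneg f) hf.1
    linarith [norm_sub_le ((1 - ε) • f) g]
  have hconst : ∀ x ∉ A, ∀ y ∉ A, ((1 - ε) • f - g) x = ((1 - ε) • f - g) y :=
    fun x hx y hy => by
      simp only [sub_apply, smul_apply]
      linarith [hfg x hx y hy]
  have hdiff : (1 - ε) * φ f - φ g ≤ 2 * ε :=
    calc (1 - ε) * φ f - φ g = φ ((1 - ε) • f - g) := by rw [map_sub, map_smul, smul_eq_mul]
      _ ≤ ‖(1 - ε) • f - g‖ * μ.toFun (gammaSet A) := hφ A _ hconst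
      _ ≤ ‖(1 - ε) • f - g‖ * ε := by gcongr
      _ ≤ 2 * ε := by gcongr
  have hφf : (1 - ε) * (1 - ε) ≤ (1 - ε) * φ f :=
    mul_le_mul_of_nonneg_left hf.2.le (by linarith)
  nlinarith

theorem exists_norm_le_one_sub_eq {f : Lip0 o} {A : Set M} {u v : M} {c : ℝ}
    (hc₀ : 0 ≤ c) (hc₁ : c ≤ 1) (hf : ‖f‖ ≤ 1)
    (h : ∀ x ∉ A, ∀ y ∉ A, c * (|f x - f y| + dist u v) ≤ dist x v + dist y u) :
    ∃ g : Lip0 o, ‖g‖ ≤ 1 ∧ (∀ x ∉ A, ∀ y ∉ A, g x - g y = c * (f x - f y)) ∧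
      g u - g v = c * dist u v := by
  have hcf : ‖c • f‖ ≤ (1 : ℝ≥0) := by
    rw [norm_smul, Real.norm_of_nonneg hc₀]
    exact mul_le_one₀ hc₁ (norm_nonneg f) hf
  have ht : |c * dist u v| ≤ (1 : ℝ≥0) * dist u v := by
    rw [abs_of_nonneg (mul_nonneg hc₀ dist_nonneg)]
    exact mul_le_mul_of_nonneg_right hc₁ dist_nonneg
  have hpair : ∀ x ∈ Aᶜ, ∀ y ∈ Aᶜ,
      |(c • f) x - (c • f) y + c * dist u v| ≤ (1 : ℝ≥0) * (dist x v + dist y u) :=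
    fun x hx y hy => by
    calc |(c • f) x - (c • f) y + c * dist u v| = c * |f x - f y + dist u v| := by
          rw [smul_apply, smul_apply, ← mul_sub, ← mul_add, abs_mul, abs_of_nonneg hc₀]
      _ ≤ c * (|f x - f y| + dist u v) := by
          gcongr
          exact (abs_add_le _ _).trans_eq (by rw [abs_dist])
      _ ≤ (1 : ℝ≥0) * (dist x v + dist y u) := by simpa using h x hx y hy
  obtain ⟨G, hG, hGf, hGuv⟩ :=
    exists_lipschitzWith_eqOn_sub_eq (lipschitzWith_of_norm_le hcf).lipschitzOnWith ht hpair
  obtain ⟨g, hg, hgG⟩ := exists_sub_eq_of_lipschitzWith o hG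
  refine ⟨g, hg, fun x hx y hy => ?_, (hgG u v).trans hGuv⟩
  rw [hgG, hGf hx, hGf hy, smul_apply, smul_apply, mul_sub]

/-- The elementary molecule `(δ_u - δ_v) / d(u, v)` as a functional on `Lip₀(M)`; it is `0` when
`u = v`. -/
noncomputable def molecule (o u v : M) : Lip0 o →L[ℝ] ℝ :=
  LinearMap.mkContinuous
    { toFun f := (f u - f v) / dist u v
      map_add' f g := by simp only [add_apply]; ring
      map_smul' c f := by simp only [smul_apply, RingHom.id_apply, smul_eq_mul]; ring }
    1 fun f => by
      rw [one_mul]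
      rcases eq_or_ne u v with rfl | huv
      · simp
      · exact abs_slope_le f ⟨(u, v), huv⟩

theorem molecule_apply (u v : M) (f : Lip0 o) : molecule o u v f = (f u - f v) / dist u v := rfl

theorem norm_molecule_le (o u v : M) : ‖molecule o u v‖ ≤ 1 :=
  LinearMap.mkContinuous_norm_le _ zero_le_one _

theorem molecule_swap_apply (u v : M) (f : Lip0 o) : molecule o v u f = -molecule o u v f := by
  rw [molecule_apply, molecule_apply, dist_comm v u, ← neg_div, neg_sub]

theorem DominatedBy.exists_mem_slice_molecule_eq {φ : Lip0 o →L[ℝ] ℝ} {μ : BA (OffDiag M)}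
    (hφ : DominatedBy φ μ) {A : Set M} {f : Lip0 o} {u v : M} {ε α : ℝ} (hε₀ : 0 < ε)
    (hε₁ : ε ≤ 1) (hεα : 4 * ε ≤ α) (hA : μ.toFun (gammaSet A) < ε) (hf : f ∈ slice φ ε)
    (huv : u ≠ v)
    (h : ∀ x ∉ A, ∀ y ∉ A, (1 - ε) * (|f x - f y| + dist u v) ≤ dist x v + dist y u) :
    ∃ g ∈ slice φ α, molecule o u v g = 1 - ε := by
  obtain ⟨g, hg, hgf, hguv⟩ :=
    exists_norm_le_one_sub_eq (sub_nonneg.2 hε₁) (sub_le_self 1 hε₀.le) hf.1 h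
  refine ⟨g, hφ.mem_slice hε₀ hε₁ hεα hA hf hg hgf, ?_⟩
  rw [molecule_apply, hguv, mul_div_cancel_right₀ _ (dist_ne_zero.2 huv)]

end Lip0

section Slices

variable {X : Type*} [NormedAddCommGroup X] [NormedSpace ℝ X]

theorem exists_mem_slice {φ : X →L[ℝ] ℝ} (hφ : ‖φ‖ = 1) {α : ℝ} (hα : 0 < α) :
    ∃ x, x ∈ slice φ α := by
  obtain ⟨x, hx, hlt⟩ := φ.exists_lt_apply_of_lt_opNorm (show 1 - α < ‖φ‖ by linarith)
  rcases abs_choice (φ x) with h | h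
  · exact ⟨x, hx.le, by rwa [Real.norm_eq_abs, h] at hlt⟩
  · exact ⟨-x, (norm_neg x).trans_le hx.le, by rwa [Real.norm_eq_abs, h, ← map_neg] at hlt⟩

theorem strongDiameterTwo_of_forall_exists_functional
    (h : ∀ (n : ℕ) (φ : Fin n → X →L[ℝ] ℝ) (α : Fin n → ℝ), (∀ i, ‖φ i‖ = 1) → (∀ i, 0 < α i) →
      ∀ δ > 0, ∃ e : X →L[ℝ] ℝ, ‖e‖ ≤ 1 ∧
        ∀ i, ∃ g ∈ slice (φ i) (α i), ∃ k ∈ slice (φ i) (α i), 2 - δ ≤ e (g - k)) :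
    StrongDiameterTwo X := by
  intro n w φ α hw hw₁ hφ hα
  set D : Set X := {x | ∃ y : Fin n → X, (∀ i, y i ∈ slice (φ i) (α i)) ∧ x = ∑ i, w i • y i}
  have hD : D ⊆ Metric.closedBall 0 1 := by
    rintro _ ⟨y, hy, rfl⟩
    exact (convex_closedBall 0 1).sum_mem (fun i _ => hw i) hw₁
      fun i _ => mem_closedBall_zero_iff.2 (hy i).1
  refine le_antisymm ?_ (le_of_forall_sub_le fun δ hδ => ?_)
  · calc Metric.diam D ≤ Metric.diam (Metric.closedBall (0 : X) 1) :=
          Metric.diam_mono hD Metric.isBounded_closedBall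
      _ ≤ 2 := (Metric.diam_closedBall zero_le_one).trans_eq (mul_one 2)
  · obtain ⟨e, he, hgk⟩ := h n φ α hφ hα δ hδ
    choose g hg k hk hgk using hgk
    calc 2 - δ = ∑ i, w i * (2 - δ) := by rw [← Finset.sum_mul, hw₁, one_mul]
      _ ≤ ∑ i, w i * e (g i - k i) :=
          Finset.sum_le_sum fun i _ => mul_le_mul_of_nonneg_left (hgk i) (hw i)
      _ = e (∑ i, w i • g i - ∑ i, w i • k i) := by
          simp only [← Finset.sum_sub_distrib, ← smul_sub, map_sum, map_smul, smul_eq_mul]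
      _ ≤ ‖∑ i, w i • g i - ∑ i, w i • k i‖ :=
          (le_abs_self _).trans (e.le_of_opNorm_le he _ |>.trans_eq (one_mul _))
      _ = dist (∑ i, w i • g i) (∑ i, w i • k i) := (dist_eq_norm _ _).symm
      _ ≤ Metric.diam D := Metric.dist_le_diam_of_mem
          (Metric.isBounded_closedBall.subset hD) ⟨g, hg, rfl⟩ ⟨k, hk, rfl⟩

end Slices

section FunctionLTP

variable {M : Type*} [MetricSpace M] {o : M}

theorem FunctionLTP.exists_abs_sub_add_le (hM : FunctionLTP o) {μ : BA (OffDiag M)}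
    (hμ : ∀ S, 0 ≤ μ.toFun S) {ε : ℝ} (hε₀ : 0 < ε) (hε₁ : ε < 1) {ι : Type*} [Finite ι]
    {f : ι → Lip0 o} (hf : ∀ i, ‖f i‖ ≤ 1) :
    ∃ (A : Set M) (u v : M), μ.toFun (gammaSet A) < ε ∧ u ≠ v ∧
      ∀ x ∉ A, ∀ y ∉ A, ∀ i, (1 - ε) * (|f i x - f i y| + dist u v) ≤ dist x u + dist y v := by
  obtain ⟨n, ⟨e⟩⟩ := Finite.exists_equiv_fin (ι ⊕ ι)
  have hnorm : ∀ j, ‖Sum.elim f (-f) j‖ ≤ 1 := by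
    rintro (i | i) <;> simpa using hf i
  obtain ⟨A, u, v, hA, -, -, huv, h⟩ := hM μ hμ ε hε₀ hε₁ n (fun j => Sum.elim f (-f) (e.symm j))
    fun j => hnorm (e.symm j)
  refine ⟨A, u, v, hA, huv, fun x hx y hy i => ?_⟩
  have hpos := h x y hx hy (e (Sum.inl i))
  have hneg := h x y hx hy (e (Sum.inr i))
  simp only [Equiv.symm_apply_apply, Sum.elim_inl, Sum.elim_inr, Pi.neg_apply,
    Lip0.neg_apply, neg_sub_neg] at hpos hneg
  rcases abs_choice (f i x - f i y) with habs | habs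
  · rwa [habs]
  · rwa [habs, neg_sub]

theorem FunctionLTP.exists_functional (hM : FunctionLTP o) {ι : Type*} [Finite ι]
    {φ : ι → Lip0 o →L[ℝ] ℝ} {α : ι → ℝ} (hφ : ∀ i, ‖φ i‖ = 1) (hα : ∀ i, 0 < α i) {δ : ℝ}
    (hδ : 0 < δ) :
    ∃ e : Lip0 o →L[ℝ] ℝ, ‖e‖ ≤ 1 ∧
      ∀ i, ∃ g ∈ slice (φ i) (α i), ∃ k ∈ slice (φ i) (α i), 2 - δ ≤ e (g - k) := by
  obtain ⟨ε, hε₀, hε₁, hεδ, hεα⟩ : ∃ ε > 0, ε < 1 ∧ 2 * ε ≤ δ ∧ ∀ i, 4 * ε ≤ α i := by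
    obtain ⟨a, ha₀, ha⟩ := Pi.exists_forall_pos_add_lt hα
    refine ⟨min (min (1 / 2) (δ / 2)) (a / 4), by positivity, ?_, ?_, fun i => ?_⟩
    · exact (min_le_left _ _).trans_lt ((min_le_left _ _).trans_lt one_half_lt_one)
    · linarith [(min_le_left (min (1 / 2) (δ / 2)) (a / 4)).trans (min_le_right _ _)]
    · linarith [min_le_right (min (1 / 2) (δ / 2)) (a / 4), ha i]
  choose f hf using fun i => exists_mem_slice (hφ i) hε₀
  obtain ⟨μ, hμ, hφμ⟩ := Lip0.exists_forall_dominatedBy φ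
  obtain ⟨A, u, v, hA, huv, hLTP⟩ := hM.exists_abs_sub_add_le hμ hε₀ hε₁ fun i => (hf i).1
  refine ⟨Lip0.molecule o u v, Lip0.norm_molecule_le o u v, fun i => ?_⟩
  obtain ⟨g, hg, hguv⟩ := (hφμ i).exists_mem_slice_molecule_eq hε₀ hε₁.le (hεα i) hA (hf i) huv
    fun x hx y hy => by simpa only [abs_sub_comm, add_comm] using hLTP y hy x hx i
  obtain ⟨k, hk, hkvu⟩ := (hφμ i).exists_mem_slice_molecule_eq hε₀ hε₁.le (hεα i) hA (hf i)
    huv.symm fun x hx y hy => by simpa only [dist_comm v u] using hLTP x hx y hy i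
  rw [Lip0.molecule_swap_apply] at hkvu
  refine ⟨g, hg, k, hk, ?_⟩
  rw [map_sub]
  linarith

theorem strongDiameterTwo_of_functionLTP (hM : FunctionLTP o) : StrongDiameterTwo (Lip0 o) :=
  strongDiameterTwo_of_forall_exists_functional fun _ _ _ hφ hα _ hδ =>
    hM.exists_functional hφ hα hδ

theorem functionLTP_of_seqLTP (o : M) (hM : SeqLTP M) : FunctionLTP o := by
  intro μ hμ ε hε₀ hε₁ n f hf
  obtain ⟨A, u, v, hA, huv, h⟩ := hM ε hε₀
  obtain ⟨m, hm⟩ := (BA.eventually_cofinite_gammaSet_lt hμ hA hε₀).exists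
  refine ⟨A m, u m, v m, hm, (huv m).1, (huv m).2.1, (huv m).2.2, fun x y hx hy i => ?_⟩
  refine (mul_le_mul_of_nonneg_left ?_ (sub_nonneg.2 hε₁.le)).trans (h m x y hx hy)
  exact add_le_add_left (Lip0.sub_le_dist (hf i) x y) _

end FunctionLTP

/-! ### The half graph -/

theorem exists_forall_notMem_of_pairwise_disjoint {X ι κ : Type*} [Infinite ι] [Finite κ]
    {A : ι → Set X} (hA : Pairwise (Function.onFun Disjoint A)) (F : κ → Filter X)
    [∀ t, (F t).NeBot] : ∃ i, ∀ t, A i ∉ F t := by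
  by_contra! h
  choose t ht using h
  obtain ⟨i, j, hij, htij⟩ := Finite.exists_ne_map_eq_of_infinite t
  exact (nonempty_of_mem (inter_mem (ht i) (htij ▸ ht j))).ne_empty (hA hij).inter_eq

/-- A symmetric function with values in `[1, 2]` off the diagonal and `0` on it is a metric: the
triangle inequality holds because `2 ≤ 1 + 1`. -/
abbrev metricSpaceOfOneLeOfLeTwo {X : Type*} (d : X → X → ℝ) (d_self : ∀ x, d x x = 0)
    (d_comm : ∀ x y, d x y = d y x) (one_le : ∀ {x y}, x ≠ y → 1 ≤ d x y)
    (le_two : ∀ x y, d x y ≤ 2) : MetricSpace X where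
  dist := d
  dist_self := d_self
  dist_comm := d_comm
  dist_triangle x y z := by
    rcases eq_or_ne x y with rfl | hxy
    · rw [d_self, zero_add]
    rcases eq_or_ne y z with rfl | hyz
    · rw [d_self, add_zero]
    linarith [one_le hxy, one_le hyz, le_two x z]
  eq_of_dist_eq_zero {x y} h := by
    by_contra hxy
    exact absurd (h ▸ one_le hxy) (by norm_num)

/-- The vertex set of the half graph, two copies `l` and `r` of `ℕ`. -/
inductive HalfGraph
  | l (i : ℕ)
  | r (k : ℕ)

namespace HalfGraph

/-- The distance `2` between `l i` and `r k` for `i < k`, which are the edges of the half graph,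
and `1` between any other two distinct vertices. -/
def halfDist : HalfGraph → HalfGraph → ℝ
  | l i, l j => if i = j then 0 else 1
  | l i, r k => if i < k then 2 else 1
  | r k, l i => if i < k then 2 else 1
  | r k, r m => if k = m then 0 else 1

instance : MetricSpace HalfGraph :=
  metricSpaceOfOneLeOfLeTwo halfDist (by rintro (i | i) <;> simp [halfDist])
    (by rintro (i | i) (j | j) <;> simp [halfDist, eq_comm])
    (by rintro (i | i) (j | j) h <;> simp only [halfDist] <;> grind)
    (by rintro (i | i) (j | j) <;> simp only [halfDist] <;> grind)

theorem one_le_dist {x y : HalfGraph} (h : x ≠ y) : 1 ≤ dist x y := by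
  rcases x with i | i <;> rcases y with j | j <;> simp only [dist, halfDist] <;> grind

theorem dist_le_two (x y : HalfGraph) : dist x y ≤ 2 := by
  rcases x with i | i <;> rcases y with j | j <;> simp only [dist, halfDist] <;> grind

theorem dist_l_r_of_lt {i k : ℕ} (h : i < k) : dist (l i) (r k) = 2 := if_pos h

theorem dist_l_r_of_le {i k : ℕ} (h : k ≤ i) : dist (l i) (r k) = 1 := if_neg h.not_gt

theorem dist_l_l {i j : ℕ} (h : i ≠ j) : dist (l i) (l j) = 1 := if_neg h

theorem dist_r_r {i j : ℕ} (h : i ≠ j) : dist (r i) (r j) = 1 := if_neg h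

theorem dist_l_l_le (i j : ℕ) : dist (l i) (l j) ≤ 1 := by
  rcases eq_or_ne i j with rfl | h
  · simp
  · exact (dist_l_l h).le

theorem dist_r_r_le (i j : ℕ) : dist (r i) (r j) ≤ 1 := by
  rcases eq_or_ne i j with rfl | h
  · simp
  · exact (dist_r_r h).le

theorem eventually_forall_abs_sub_le {o : HalfGraph} {f : Lip0 o} (hf : ‖f‖ ≤ 1) {δ : ℝ}
    (hδ : 0 < δ) : ∀ᶠ a in atTop, ∀ k, |f (l a) - f (r k)| ≤ 1 + δ := by
  -- Let `f (l a)` cluster at `c` along the bad `a`. If `k` is a witness for one of them, a bad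
  -- `b ≥ k` with `f (l b)` near `f (l a)` contradicts `dist (l b) (r k) = 1`.
  by_contra hbad
  simp only [not_eventually, not_forall, not_le] at hbad
  have : (atTop ⊓ 𝓟 {a | ∃ k, 1 + δ < |f (l a) - f (r k)|}).NeBot :=
    frequently_mem_iff_neBot.1 hbad
  have hbdd : ∀ a, f (l a) ∈ Metric.closedBall (0 : ℝ) 2 := fun a => by
    simpa [Lip0.map_base] using (Lip0.abs_sub_le_dist hf (l a) o).trans (dist_le_two _ _)
  obtain ⟨c, -, hc⟩ := (isCompact_closedBall (0 : ℝ) 2).exists_mapClusterPt_of_frequently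
    (l := atTop ⊓ 𝓟 {a | ∃ k, 1 + δ < |f (l a) - f (r k)|}) (Frequently.of_forall hbdd)
  have hnear : ∃ᶠ a in atTop, (∃ k, 1 + δ < |f (l a) - f (r k)|) ∧ |f (l a) - c| < δ / 2 := by
    have := hc.frequently (Metric.ball_mem_nhds c (half_pos hδ))
    simpa [frequently_inf_principal, Real.dist_eq] using this
  obtain ⟨a, ⟨k, hk⟩, hac⟩ := hnear.exists
  obtain ⟨b, ⟨-, hbc⟩, hkb⟩ := (hnear.and_eventually (eventually_ge_atTop k)).exists
  have hbk := Lip0.abs_sub_le_dist hf (l b) (r k)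
  rw [dist_l_r_of_le hkb] at hbk
  grind

theorem sub_le_or_three_le {o : HalfGraph} {f : Lip0 o} (hf : ‖f‖ ≤ 1) {δ : ℝ} (hδ : 0 ≤ δ)
    {N p q : ℕ} (hN : ∀ a ≥ N, ∀ k, |f (l a) - f (r k)| ≤ 1 + δ) (hp : N ≤ p) (hq : N ≤ q)
    {x y : HalfGraph} (hx : x ≠ r p) (hy : y ≠ r q) :
    f x - f y ≤ 1 + δ ∨ 3 ≤ dist x (r p) + dist y (r q) := by
  rcases x with a | a <;> rcases y with b | b
  · left
    linarith [Lip0.sub_le_dist hf (l a) (l b), dist_l_l_le a b]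
  · rcases le_or_gt N a with ha | ha
    · exact .inl ((le_abs_self _).trans (hN a ha b))
    · right
      linarith [dist_l_r_of_lt (ha.trans_le hp), one_le_dist hy]
  · rcases le_or_gt N b with hb | hb
    · exact .inl ((le_abs_self _).trans ((abs_sub_comm _ _).trans_le (hN b hb a)))
    · right
      linarith [dist_l_r_of_lt (hb.trans_le hq), one_le_dist hx]
  · left
    linarith [Lip0.sub_le_dist hf (r a) (r b), dist_r_r_le a b]

theorem functionLTP (o : HalfGraph) : FunctionLTP o := by
  intro μ hμ ε hε₀ hε₁ n f hf
  have hN := eventually_all.2 fun i => eventually_forall_abs_sub_le (hf i) (mul_pos two_pos hε₀)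
  obtain ⟨N, hN⟩ := eventually_atTop.1 hN
  have hdisj : Pairwise (Function.onFun Disjoint fun m => ({r (2 * m), r (2 * m + 1)} : Set _)) :=
    fun m m' hm => by
      simp only [Function.onFun, Set.disjoint_insert_left, Set.disjoint_singleton_left,
        Set.mem_insert_iff, Set.mem_singleton_iff, r.injEq]
      omega
  have hsmall := BA.eventually_cofinite_gammaSet_lt hμ hdisj hε₀
  rw [Nat.cofinite_eq_atTop] at hsmall
  obtain ⟨m, hm, hNm⟩ := (hsmall.and (eventually_ge_atTop N)).exists
  refine ⟨_, r (2 * m), r (2 * m + 1), hm, by simp, by simp, by simp, fun x y hx hy i => ?_⟩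
  simp only [Set.mem_insert_iff, Set.mem_singleton_iff, not_or] at hx hy
  rw [dist_r_r (2 * m).succ_ne_self.symm]
  rcases sub_le_or_three_le (hf i) (by positivity) (fun a ha => hN a ha i)
    (show N ≤ 2 * m by omega) (show N ≤ 2 * m + 1 by omega) hx.1 hy.2 with hle | hge
  · calc (1 - ε) * (f i x - f i y + 1) ≤ (1 - ε) * (1 + 2 * ε + 1) := by gcongr
      _ ≤ 1 + 1 := by nlinarith
      _ ≤ _ := add_le_add (one_le_dist hx.1) (one_le_dist hy.2)
  · calc (1 - ε) * (f i x - f i y + 1) ≤ (1 - ε) * (2 + 1) := by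
          gcongr
          exact (Lip0.sub_le_dist (hf i) x y).trans (dist_le_two x y)
      _ ≤ 3 := by linarith
      _ ≤ _ := hge

theorem exists_dist_eq_two {A : Set HalfGraph} (h₀ : l 0 ∉ A) (h₁ : r 1 ∉ A)
    (hl : ∃ᶠ i in atTop, l i ∉ A) (hr : ∃ᶠ k in atTop, r k ∉ A) {u v : HalfGraph} (hu : u ∈ A)
    (hv : v ∈ A) : ∃ x ∉ A, ∃ y ∉ A, dist x y = 2 ∧ dist x u = 1 ∧ dist y v = 1 := by
  have hl₀ : ∀ {i}, l i ∈ A → 0 ≠ i := by rintro i hi rfl; exact h₀ hi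
  have hr₁ : ∀ {k}, r k ∈ A → 1 ≠ k := by rintro k hk rfl; exact h₁ hk
  have h₀₁ : dist (l 0) (r 1) = 2 := dist_l_r_of_lt one_pos
  rcases u with i | i
  · refine ⟨l 0, h₀, r 1, h₁, h₀₁, dist_l_l (hl₀ hu), ?_⟩
    rcases v with j | j
    · rw [dist_comm, dist_l_r_of_le (Nat.one_le_iff_ne_zero.2 (hl₀ hv).symm)]
    · exact dist_r_r (hr₁ hv)
  rcases v with j | j
  · exact ⟨r 1, h₁, l 0, h₀, (dist_comm _ _).trans h₀₁, dist_r_r (hr₁ hu), dist_l_l (hl₀ hv)⟩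
  · obtain ⟨a, haA, hia⟩ := (hl.and_eventually (eventually_ge_atTop i)).exists
    obtain ⟨k, hkA, hak⟩ := (hr.and_eventually (eventually_gt_atTop a)).exists
    refine ⟨l a, haA, r k, hkA, dist_l_r_of_lt hak, dist_l_r_of_le hia, dist_r_r ?_⟩
    rintro rfl
    exact hkA hv

theorem not_seqLTP : ¬ SeqLTP HalfGraph := by
  intro hM
  obtain ⟨A, u, v, hA, huv, h⟩ := hM (1 / 4) (by norm_num)
  let F : Fin 4 → Filter HalfGraph := ![pure (l 0), pure (r 1), map l atTop, map r atTop]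
  have : ∀ t, (F t).NeBot := by
    simp only [F, Fin.forall_fin_succ]
    exact ⟨pure_neBot, pure_neBot, map_neBot, map_neBot, finZeroElim⟩
  obtain ⟨m, hm⟩ := exists_forall_notMem_of_pairwise_disjoint hA F
  have hl : ∃ᶠ i in atTop, l i ∉ A m := not_eventually.1 (hm 2)
  have hr : ∃ᶠ k in atTop, r k ∉ A m := not_eventually.1 (hm 3)
  obtain ⟨x, hx, y, hy, hxy, hxu, hyv⟩ :=
    exists_dist_eq_two (hm 0) (hm 1) hl hr (huv m).1 (huv m).2.1
  have hle := h m x y hx hy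
  rw [hxy, hxu, hyv] at hle
  linarith [one_le_dist (huv m).2.2]

end HalfGraph

theorem mainTheorem4 :
    (∀ (M : Type*) [MetricSpace M] (o : M), FunctionLTP o → StrongDiameterTwo (Lip0 o)) ∧
    (∀ (M : Type*) [MetricSpace M] (o : M), SeqLTP M → FunctionLTP o) ∧
    (∃ (M : Type) (_ : MetricSpace M) (o : M), FunctionLTP o ∧ ¬ SeqLTP M) :=
  ⟨fun _ _ _ => strongDiameterTwo_of_functionLTP, fun _ _ o => functionLTP_of_seqLTP o,
    HalfGraph, inferInstance, HalfGraph.l 0, HalfGraph.functionLTP _, HalfGraph.not_seqLTP⟩
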